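/- Let $\mathcal A$ be a finite set of hyperplanes through the origin in $\mathbb R^d$, and fix for each $H\in\mathcal A$ a labelling of its two open half-spaces as $H^+$ and $H^-$; put $H^0=H$. A face of $\mathcal A$ is a nonempty set of the form $x=\bigcap_{H\in\mathcal A}H^{\sigma_H(x)}$ with $\sigma_H(x)\in\{+,-,0\}$. The set $\mathcal F$ of faces is a finite monoid under the product for which $\sigma_H(xy)=\sigma_H(x)$ if $\sigma_H(x)\neq 0$ and $\sigma_H(xy)=\sigma_H(y)$ if $\sigma_H(x)=0$; its identity is $\bigcap_{H\in\mathcal A}H$. The support of a face $x$ is $\operatorname{supp}(x)=\bigcap_{H:\,\sigma_H(x)=0}H$, and $\mathcal L=\operatorname{supp}(\mathcal F)$, ordered by inclusion, is the intersection lattice of $\mathcal A$. Let $\mu$ be its Möbius function: $\mu(X,X)=1$, $\mu(X,Y)=-\sum_{X\le Z<Y}\mu(X,Z)$ for $X<Y$, and $\mu(X,Y)=0$ if $X\not\le Y$. Let $k$ be a field (of any characteristic) and $k\mathcal F$ the semigroup algebra of $\mathcal F$. For each $X\in\mathcal L$ fix a face $x$ with $\operatorname{supp}(x)=X$, and define $e_X\in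 k\mathcal F$ recursively by $$e_X=x-\sum_{Y>X}x\,e_Y .$$ Then $(e_X)_{X\in\mathcal L}$ is a complete system of primitive orthogonal idempotents of $k\mathcal F$ (each $e_X$ is a nonzero idempotent that is not a sum of two nonzero orthogonal idempotents, $e_Xe_Y=0$ for $X\ne Y$, and $\sum_X e_X=1$), and for all $X,Y\in\mathcal L$ the space $\operatorname{Hom}_{k\mathcal F}(k\mathcal F e_X,k\mathcal F e_Y)$ of homomorphisms of left $k\mathcal F$-modules is finite-dimensional over $k$, with $$c_{X,Y}:=\dim_k\operatorname{Hom}_{k\mathcal F}(k\mathcal F e_X,k\mathcal F e_Y)=|\mu(X,Y)| .$$ Consequently the Cartan matrix $[c_{X,Y}]_{X,Y\in\mathcal L}$ of $k\mathcal F$ is upper triangular for some enumeration of $\mathcal L$ compatible with its partial order, and its determinant is $1$. -/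

import Mathlib

/-- A central hyperplane arrangement in a real vector space `V`: a finite set of hyperplanes
through the origin, together with a choice, for each hyperplane `H`, of its two sides. The choice is
recorded by a linear form with kernel `H`; the positive side of `H` is where the form is positive. -/
structure CentralArrangement (V : Type*) [AddCommGroup V] [Module ℝ V] where
  /-- The hyperplanes. -/
  hyperplanes : Finset (Submodule ℝ V)
  isCoatom_of_mem : ∀ H ∈ hyperplanes, IsCoatom H
  /-- A linear form choosing the sides of each hyperplane. -/
  form : hyperplanes → Module.Dual ℝ V
  ker_form : ∀ H : hyperplanes, LinearMap.ker (form H) = H.1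

namespace CentralArrangement

variable {V : Type*} [AddCommGroup V] [Module ℝ V] (A : CentralArrangement V)

/-- `H⁺`, `H⁻` and `H⁰ = H`, according to the given sign. -/
def side (H : A.hyperplanes) : SignType → Set V
  | .pos => {v | 0 < A.form H v}
  | .neg => {v | A.form H v < 0}
  | .zero => {v | v ∈ H.1}

theorem mem_side_iff (H : A.hyperplanes) (s : SignType) (v : V) :
    v ∈ A.side H s ↔ SignType.sign (A.form H v) = s := by
  cases s with
  | pos => exact (sign_eq_one_iff (a := A.form H v)).symm
  | neg => exact (sign_eq_neg_one_iff (a := A.form H v)).symm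
  | zero =>
    change v ∈ H.1 ↔ SignType.sign (A.form H v) = 0
    rw [sign_eq_zero_iff, ← A.ker_form H, LinearMap.mem_ker]

/-- A face of the arrangement, encoded by its sign sequence: a family of signs for which the
intersection of the corresponding sides is nonempty (see `Face.carrier` and
`Face.carrier_injective`). -/
@[ext]
structure Face where
  /-- The sign sequence. -/
  sign : A.hyperplanes → SignType
  nonempty : (⋂ H, A.side H (sign H)).Nonempty

variable {A}

/-- The face as a subset of `V`. -/
def Face.carrier (x : A.Face) : Set V := ⋂ H, A.side H (x.sign H)

theorem Face.mem_carrier_iff (x : A.Face) (v : V) :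
    v ∈ x.carrier ↔ ∀ H, SignType.sign (A.form H v) = x.sign H := by
  simp [Face.carrier, mem_side_iff]

/-- A face is determined by its set of points, so sign sequences encode faces faithfully. -/
theorem Face.carrier_injective : Function.Injective (Face.carrier (A := A)) := by
  intro x y h
  obtain ⟨v, hv⟩ := x.nonempty
  have hx := (x.mem_carrier_iff v).1 hv
  have hy := (y.mem_carrier_iff v).1 (h ▸ hv)
  ext H : 2
  rw [← hx H, hy H]

instance : Finite A.Face :=
  Finite.of_injective Face.sign fun _ _ h => Face.ext h

/-- The product of two faces: the sign of `x * y` at `H` is that of `x` if this is nonzero, and that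
of `y` otherwise. -/
instance : Mul A.Face where
  mul x y :=
    { sign := fun H => if x.sign H ≠ 0 then x.sign H else y.sign H
      nonempty := by
        obtain ⟨p, hp⟩ := x.nonempty
        obtain ⟨q, hq⟩ := y.nonempty
        have hp' := (x.mem_carrier_iff p).1 hp
        have hq' := (y.mem_carrier_iff q).1 hq
        have key : ∀ H, ∀ᶠ t : ℝ in nhdsWithin 0 (Set.Ioi 0),
            SignType.sign (A.form H (p + t • q)) =
              if x.sign H ≠ 0 then x.sign H else y.sign H := by
          intro H
          have hc : Filter.Tendsto (fun t : ℝ => A.form H (p + t • q))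
              (nhdsWithin 0 (Set.Ioi 0)) (nhds (A.form H p)) := by
            have : Continuous (fun t : ℝ => A.form H p + t * A.form H q) := by fun_prop
            have h2 := (this.tendsto 0).mono_left (nhdsWithin_le_nhds (s := Set.Ioi 0))
            simpa using h2
          rcases lt_trichotomy (A.form H p) 0 with h | h | h
          · have hs : x.sign H = -1 := by rw [← hp' H, sign_neg h]
            filter_upwards [hc.eventually_lt_const h] with t ht
            rw [sign_neg ht, hs, if_pos (by decide)]
          · have hs : x.sign H = 0 := by rw [← hp' H, h, sign_zero]
            filter_upwards [self_mem_nhdsWithin] with t ht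
            have ht' : (0 : ℝ) < t := ht
            rw [map_add, h, zero_add, map_smul, smul_eq_mul, sign_mul, sign_pos ht', one_mul,
              hq' H, hs]
            simp
          · have hs : x.sign H = 1 := by rw [← hp' H, sign_pos h]
            filter_upwards [hc.eventually_const_lt h] with t ht
            rw [sign_pos ht, hs, if_pos (by decide)]
        obtain ⟨t, ht⟩ := (Filter.eventually_all.2 key).exists
        exact ⟨p + t • q, Set.mem_iInter.2 fun H => (A.mem_side_iff H _ _).2 (ht H)⟩ }

theorem Face.mul_sign (x y : A.Face) (H : A.hyperplanes) :
    (x * y).sign H = if x.sign H ≠ 0 then x.sign H else y.sign H := rfl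

/-- The identity face: all signs are zero, i.e. the intersection of all the hyperplanes. -/
instance : One A.Face where
  one :=
    { sign := fun _ => 0
      nonempty := ⟨0, Set.mem_iInter.2 fun H => (A.mem_side_iff H _ _).2 (by simp)⟩ }

theorem Face.one_sign (H : A.hyperplanes) : (1 : A.Face).sign H = 0 := rfl

/-- The face semigroup, which has an identity. -/
instance : Monoid A.Face where
  mul_assoc x y z := by
    ext H : 2
    simp only [Face.mul_sign]
    by_cases h : x.sign H = 0 <;> simp [h]
  one_mul x := by
    ext H : 2
    simp [Face.mul_sign, Face.one_sign]
  mul_one x := by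
    ext H : 2
    by_cases h : x.sign H = 0 <;> simp [Face.mul_sign, Face.one_sign, h]

/-- The intersection of the hyperplanes of the arrangement containing the face `x`. -/
def Face.span (x : A.Face) : Submodule ℝ V :=
  ⨅ (H : A.hyperplanes) (_ : x.sign H = 0), H.1

variable (A)

/-- The intersection lattice: the set of supports of the faces, ordered by inclusion. -/
abbrev IntersectionLattice : Type _ := {X : Submodule ℝ V // X ∈ Set.range (Face.span (A := A))}

variable {A}

/-- The support map from faces to the intersection lattice. -/
def Face.supp (x : A.Face) : A.IntersectionLattice := ⟨x.span, x, rfl⟩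

theorem Face.supp_surjective : Function.Surjective (Face.supp (A := A)) := by
  rintro ⟨_, x, rfl⟩
  exact ⟨x, rfl⟩

instance : Finite A.IntersectionLattice := Finite.of_surjective _ Face.supp_surjective

noncomputable instance : Fintype A.IntersectionLattice := Fintype.ofFinite _

noncomputable instance : DecidableEq A.IntersectionLattice := Classical.decEq _

open Classical in
noncomputable instance : LocallyFiniteOrder A.IntersectionLattice :=
  Fintype.toLocallyFiniteOrder

/-- The Möbius function of the intersection lattice. -/
noncomputable def mobius (X Y : A.IntersectionLattice) : ℤ := IncidenceAlgebra.mu ℤ X Y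

variable (k : Type*) [Field k]

open Classical in
/-- The elements `e_X = x - ∑_{Y > X} x e_Y` of the face semigroup algebra, defined by recursion
down the intersection lattice, where `x = c X` is the chosen face of support `X`. -/
noncomputable def idem (c : A.IntersectionLattice → A.Face) (X : A.IntersectionLattice) :
    MonoidAlgebra k A.Face :=
  MonoidAlgebra.of k A.Face (c X) -
    ∑ Y : {Y : A.IntersectionLattice // X < Y}, MonoidAlgebra.of k A.Face (c X) * idem c Y.1
termination_by wellFounded_gt.wrap X
decreasing_by exact Y.2

open Classical in
theorem idem_eq (c : A.IntersectionLattice → A.Face) (X : A.IntersectionLattice) :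
    idem k c X = MonoidAlgebra.of k A.Face (c X) -
      ∑ Y ∈ Finset.univ.filter (X < ·), MonoidAlgebra.of k A.Face (c X) * idem k c Y := by
  rw [idem]
  congr 1
  exact (Finset.sum_subtype _ (by simp) fun Y =>
    MonoidAlgebra.of k A.Face (c X) * idem k c Y).symm

end CentralArrangement

section Cartan

variable (k : Type*) {R : Type*} [Field k] [Ring R] [Algebra k R]

/-- A primitive idempotent of a ring: a nonzero idempotent that is not the sum of two nonzero
orthogonal idempotents. -/
def IsPrimitiveIdempotent {R : Type*} [Ring R] (e : R) : Prop :=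
  IsIdempotentElem e ∧ e ≠ 0 ∧
    ¬ ∃ e₁ e₂ : R, IsIdempotentElem e₁ ∧ IsIdempotentElem e₂ ∧ e₁ ≠ 0 ∧ e₂ ≠ 0 ∧
      e₁ * e₂ = 0 ∧ e₂ * e₁ = 0 ∧ e = e₁ + e₂

/-- A complete system of primitive orthogonal idempotents of a ring. -/
def IsCompletePrimitiveSystem {R I : Type*} [Ring R] [Fintype I] (e : I → R) : Prop :=
  CompleteOrthogonalIdempotents e ∧ ∀ i, IsPrimitiveIdempotent (e i)

/-- The space `Hom_R(R e, R f)` of homomorphisms of left `R`-modules. -/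
abbrev LeftIdealHom {R : Type*} [Ring R] (e f : R) : Type _ :=
  (Submodule.span R {e} : Submodule R R) →ₗ[R] (Submodule.span R {f} : Submodule R R)

/-- The Cartan invariants `c i j = dim_k Hom_R(R e_i, R e_j)` of the `k`-algebra `R` with respect to
the family `e`. -/
noncomputable def cartanInvariant {I : Type*} (e : I → R) (i j : I) : ℕ :=
  Module.finrank k (LeftIdealHom (e i) (e j))

/-- The Cartan matrix, with integer entries. -/
noncomputable def cartanMatrix {I : Type*} (e : I → R) : Matrix I I ℤ :=
  Matrix.of fun i j => (cartanInvariant k e i j : ℤ)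

end Cartan

/-! ### Supports and products of faces -/

namespace CentralArrangement

variable {V : Type*} [AddCommGroup V] [Module ℝ V] {A : CentralArrangement V}

/-! Write `R` for the face algebra and `x` for the chosen face of support `X`. Since `Hom_R(R e, R
f)` is `e R f`, everything rests on `dim e_X R e_Y`, obtained by computing `dim x R e_Y` twice. The
rules `e_Z x = e_Z` for `X ≤ Z` (`idem_mul_of`) and `x e_Z = 0` otherwise (`of_mul_idem_eq_zero`)
split `x R e_Y` into the spaces `e_Z R e_Y`, `Z ≥ X` (`cornerOfEquiv`). It also has the basis `w
e_Y`, with `w` of support `Y` and `x w = w`. So if `C` is the matrix of dimensions, `ζ C` counts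
these faces, over any field.

The faces `w` with `x w = w` and support below `Y` partition a convex, relatively open cone in `Y`,
so the sum of their signs `(-1) ^ dim w` is `(-1) ^ dim Y` (`Face.sum_dimSign`). With `D` the
diagonal matrix of such signs this reads `ζ C D ζ = ζ D`, hence `C = D μ D`. Dimensions are
nonnegative, so they equal `|μ|`. The diagonal entries are `1`, which yields primitivity and the
determinant. -/

theorem Face.exists_mem_carrier (x : A.Face) :
    ∃ v, ∀ H, SignType.sign (A.form H v) = x.sign H := by
  obtain ⟨v, hv⟩ := x.nonempty
  exact ⟨v, (x.mem_carrier_iff v).1 hv⟩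

theorem Face.mem_span_iff (x : A.Face) (v : V) :
    v ∈ x.span ↔ ∀ H, x.sign H = 0 → A.form H v = 0 := by
  simp only [Face.span, Submodule.mem_iInf]
  refine forall₂_congr fun H _ => ?_
  rw [← A.ker_form H, LinearMap.mem_ker]

/-- A point of the face `x` lies on exactly those hyperplanes where `x` has sign zero, so one such
point tests the inclusion. -/
theorem Face.supp_le_supp_iff (x y : A.Face) :
    x.supp ≤ y.supp ↔ ∀ H, y.sign H = 0 → x.sign H = 0 := by
  constructor
  · intro h H hH
    obtain ⟨v, hv⟩ := x.exists_mem_carrier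
    have hx : v ∈ x.span := (x.mem_span_iff v).2 fun H hH => sign_eq_zero_iff.1 ((hv H).trans hH)
    rw [← hv H, (y.mem_span_iff v).1 (h hx) H hH, sign_zero]
  · intro h v hv
    exact (y.mem_span_iff v).2 fun H hH => (x.mem_span_iff v).1 hv H (h H hH)

theorem Face.mul_sign_eq_zero_iff (x y : A.Face) (H : A.hyperplanes) :
    (x * y).sign H = 0 ↔ x.sign H = 0 ∧ y.sign H = 0 := by
  rw [Face.mul_sign]
  by_cases h : x.sign H = 0 <;> simp [h]

/-- The support of a product is the join of the supports, because its zero signs are the common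
ones. -/
theorem Face.supp_mul_le_iff (x y : A.Face) (Z : A.IntersectionLattice) :
    (x * y).supp ≤ Z ↔ x.supp ≤ Z ∧ y.supp ≤ Z := by
  obtain ⟨z, rfl⟩ := Face.supp_surjective Z
  simp only [Face.supp_le_supp_iff, Face.mul_sign_eq_zero_iff]
  exact ⟨fun h => ⟨fun H hH => (h H hH).1, fun H hH => (h H hH).2⟩,
    fun h H hH => ⟨h.1 H hH, h.2 H hH⟩⟩

theorem Face.supp_le_supp_mul_left (x y : A.Face) : x.supp ≤ (x * y).supp :=
  ((Face.supp_mul_le_iff x y _).1 le_rfl).1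

theorem Face.supp_le_supp_mul_right (x y : A.Face) : y.supp ≤ (x * y).supp :=
  ((Face.supp_mul_le_iff x y _).1 le_rfl).2

theorem Face.mul_eq_left {x y : A.Face} (h : y.supp ≤ x.supp) : x * y = x := by
  rw [Face.supp_le_supp_iff] at h
  ext H : 2
  rw [Face.mul_sign]
  by_cases hx : x.sign H = 0
  · simp [hx, h H hx]
  · simp [hx]

theorem Face.mul_eq_right_iff (x w : A.Face) :
    x * w = w ↔ ∀ H, x.sign H ≠ 0 → w.sign H = x.sign H := by
  constructor
  · intro h H hH
    rw [← h, Face.mul_sign, if_pos hH]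
  · intro h
    ext H : 2
    rw [Face.mul_sign]
    split_ifs with hH
    · exact (h H hH).symm
    · rfl

theorem Face.supp_one_le (Z : A.IntersectionLattice) : (1 : A.Face).supp ≤ Z := by
  obtain ⟨z, rfl⟩ := Face.supp_surjective Z
  exact (Face.supp_le_supp_iff _ _).2 fun _ _ => rfl

theorem Face.eq_one_of_supp_eq {x : A.Face} (h : x.supp = (1 : A.Face).supp) : x = 1 := by
  rw [← one_mul x]
  exact Face.mul_eq_left h.le

/-! ### Orthogonality of the elements `e_X` -/

open MonoidAlgebra in
theorem monoidAlgebra_hom_ext {k R M : Type*} [Field k] [Monoid M] [AddCommGroup R] [Module k R]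
    {f g : MonoidAlgebra k M →ₗ[k] R} (h : ∀ w, f (of k M w) = g (of k M w)) (r) :
    f r = g r := by
  induction r using MonoidAlgebra.induction_on with
  | of m => exact h m
  | add x y hx hy => rw [map_add, map_add, hx, hy]
  | smul c x hx => rw [map_smul, map_smul, hx]

variable (k : Type*) [Field k] (c : A.IntersectionLattice → A.Face)

local notation "ι" => MonoidAlgebra.of k A.Face

open Classical in
theorem idem_eq_of_mul (X : A.IntersectionLattice) :
    idem k c X = ι (c X) * (1 - ∑ Y ∈ Finset.univ.filter (X < ·), idem k c Y) := by
  rw [idem_eq, mul_sub, mul_one, Finset.mul_sum]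

/-- Right multiplication by a face of smaller support acts trivially. -/
theorem of_mul_mul_of {z x : A.Face} (h : x.supp ≤ z.supp) (r : MonoidAlgebra k A.Face) :
    ι z * r * ι x = ι z * r := by
  refine monoidAlgebra_hom_ext (f := LinearMap.mulRight k (ι x) ∘ₗ LinearMap.mulLeft k (ι z))
    (g := LinearMap.mulLeft k (ι z)) (fun w => ?_) r
  simp only [LinearMap.comp_apply, LinearMap.mulLeft_apply, LinearMap.mulRight_apply, ← map_mul]
  rw [Face.mul_eq_left (h.trans (Face.supp_le_supp_mul_left z w))]

/-- Elements of `z * kF` are combinations of faces whose support contains that of `z`. -/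
theorem coeff_of_mul_eq_zero {z w : A.Face} (h : ¬ z.supp ≤ w.supp) (r : MonoidAlgebra k A.Face) :
    (ι z * r).coeff w = 0 := by
  rw [MonoidAlgebra.of_apply]
  apply MonoidAlgebra.coeff_single_mul_of_forall_mul_ne
  rintro d rfl
  exact h (Face.supp_le_supp_mul_left z d)

variable {c}

theorem of_mul_idem_self (X : A.IntersectionLattice) : ι (c X) * idem k c X = idem k c X := by
  rw [idem_eq_of_mul, ← mul_assoc, ← map_mul, Face.mul_eq_left le_rfl]

section

variable (hc : ∀ X, (c X).supp = X)
include hc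

theorem idem_mul_of {X : A.IntersectionLattice} {x : A.Face} (h : x.supp ≤ X) :
    idem k c X * ι x = idem k c X := by
  rw [idem_eq_of_mul, of_mul_mul_of k (h.trans (hc X).ge)]

-- Here `w * c X = w`, so `w e_X` obeys the recursion with `w` in place of the chosen face.
open Classical in
theorem of_mul_idem_of_supp_eq {w : A.Face} {X : A.IntersectionLattice} (h : w.supp = X) :
    ι w * idem k c X = ι w - ∑ Y ∈ Finset.univ.filter (X < ·), ι w * idem k c Y := by
  rw [idem_eq_of_mul, ← mul_assoc, ← map_mul, Face.mul_eq_left (by rw [hc, h]), mul_sub, mul_one,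
    Finset.mul_sum]

/-- Induction down the lattice. Put `u = w * c X`, whose support is strictly above `X`. By induction
`u` kills every `e_Y` with `Y > X` except those with `Y ≥ supp u`, and `u` minus the sum of the
remaining `u e_Y` is zero by the recursion at `supp u`. -/
theorem of_mul_idem_eq_zero (X : A.IntersectionLattice) :
    ∀ {w : A.Face}, ¬ w.supp ≤ X → ι w * idem k c X = 0 := by
  classical
  induction X using (wellFounded_gt (α := A.IntersectionLattice)).induction with
  | _ X ih =>
  intro w hw
  rw [idem_eq_of_mul, ← mul_assoc, ← map_mul]
  set u := w * c X with hu
  have hXu : X < u.supp := by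
    refine lt_of_le_of_ne ((hc X).ge.trans (Face.supp_le_supp_mul_right _ _)) fun h => hw ?_
    exact (Face.supp_le_supp_mul_left w (c X)).trans h.ge
  have hsum : ∑ Y ∈ Finset.univ.filter (X < ·), ι u * idem k c Y
      = ∑ Y ∈ Finset.univ.filter (u.supp ≤ ·), ι u * idem k c Y := by
    symm
    refine Finset.sum_subset (fun Y hY => ?_) fun Y hY hY' => ?_
    · simp only [Finset.mem_filter, Finset.mem_univ, true_and] at hY ⊢
      exact hXu.trans_le hY
    · simp only [Finset.mem_filter, Finset.mem_univ, true_and] at hY hY'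
      exact ih Y hY hY'
  have hsplit : (Finset.univ.filter (u.supp ≤ ·) : Finset A.IntersectionLattice)
      = insert u.supp (Finset.univ.filter (u.supp < ·)) := by
    ext Y
    simp [le_iff_eq_or_lt, eq_comm]
  rw [mul_sub, mul_one, Finset.mul_sum, hsum, hsplit, Finset.sum_insert (by simp),
    of_mul_idem_of_supp_eq k hc rfl]
  abel

/-- `e_X r` lies in `c X * R`, so it is a combination of faces with support above `X`, and each of
these kills `e_Y`. -/
theorem idem_mul_mul_idem_eq_zero {X Y : A.IntersectionLattice} (h : ¬ X ≤ Y)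
    (r : MonoidAlgebra k A.Face) : idem k c X * r * idem k c Y = 0 := by
  rw [idem_eq_of_mul, mul_assoc (ι (c X))]
  set s := (1 - _) * r
  refine monoidAlgebra_hom_ext
    (f := LinearMap.mulRight k (idem k c Y) ∘ₗ LinearMap.mulLeft k (ι (c X)))
    (g := 0) (fun w => ?_) s
  simp only [LinearMap.comp_apply, LinearMap.mulLeft_apply, LinearMap.mulRight_apply, ← map_mul,
    LinearMap.zero_apply]
  exact of_mul_idem_eq_zero k hc Y fun h' =>
    h ((hc X).ge.trans ((Face.supp_le_supp_mul_left (c X) w).trans h'))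

theorem idem_mul_idem_eq_zero_of_not_le {X Y : A.IntersectionLattice} (h : ¬ X ≤ Y) :
    idem k c X * idem k c Y = 0 := by
  simpa using idem_mul_mul_idem_eq_zero k hc h 1

theorem idem_isIdempotentElem (X : A.IntersectionLattice) : IsIdempotentElem (idem k c X) := by
  classical
  have h0 : ∀ Y ∈ Finset.univ.filter (X < ·), idem k c Y * idem k c X = 0 := fun Y hY =>
    idem_mul_idem_eq_zero_of_not_le k hc (Finset.mem_filter.1 hY).2.not_ge
  unfold IsIdempotentElem
  nth_rewrite 1 [idem_eq_of_mul]
  rw [mul_assoc, sub_mul, one_mul, Finset.sum_mul, Finset.sum_eq_zero h0, sub_zero]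
  exact of_mul_idem_self k X

/-- In `c X * (1 - ∑ e_Z) * e_Y` the only surviving term of the sum is `Z = Y`, by induction down
the lattice, and it cancels the `1`. -/
theorem idem_mul_idem_of_lt (Y X : A.IntersectionLattice) (h : X < Y) :
    idem k c X * idem k c Y = 0 := by
  classical
  induction X using (wellFounded_gt (α := A.IntersectionLattice)).induction with
  | _ X ih =>
  have h0 : ∑ Z ∈ Finset.univ.filter (X < ·), idem k c Z * idem k c Y = idem k c Y := by
    rw [Finset.sum_eq_single_of_mem Y (by simpa using h)]
    · exact idem_isIdempotentElem k hc Y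
    · intro Z hZ hZY
      by_cases hle : Z ≤ Y
      · exact ih Z (Finset.mem_filter.1 hZ).2 (lt_of_le_of_ne hle hZY)
      · exact idem_mul_idem_eq_zero_of_not_le k hc hle
  rw [idem_eq_of_mul, mul_assoc, sub_mul, one_mul, Finset.sum_mul, h0, sub_self, mul_zero]

/-- The only face with the bottom support is `1`, so the recursion at the bottom is this identity.
-/
theorem sum_idem : ∑ X, idem k c X = 1 := by
  classical
  set B : A.IntersectionLattice := (1 : A.Face).supp with hB
  have hfil : (Finset.univ : Finset A.IntersectionLattice)
      = insert B (Finset.univ.filter (B < ·)) := by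
    ext Y
    have : B = Y ∨ B < Y := le_iff_eq_or_lt.1 (Face.supp_one_le Y)
    simpa [eq_comm] using this
  rw [hfil, Finset.sum_insert (by simp), idem_eq_of_mul, Face.eq_one_of_supp_eq (hc B), map_one,
    one_mul, sub_add_cancel]

theorem completeOrthogonalIdempotents_idem : CompleteOrthogonalIdempotents (idem k c) where
  idem := idem_isIdempotentElem k hc
  ortho X Y hXY := by
    by_cases h : X ≤ Y
    · exact idem_mul_idem_of_lt k hc Y X (lt_of_le_of_ne h hXY)
    · exact idem_mul_idem_eq_zero_of_not_le k hc h
  complete := sum_idem k hc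

end

end CentralArrangement

/-! ### Homomorphisms of left ideals and the spaces `e R f` -/

section Corner

variable (k : Type*) {R : Type*} [Field k] [Ring R] [Algebra k R]

/-- The subspace `e R f` of a `k`-algebra `R`. -/
def corner (e f : R) : Submodule k R :=
  LinearMap.range (LinearMap.mulRight k f ∘ₗ LinearMap.mulLeft k e)

variable {k}

theorem mul_eq_of_mem_corner_left {e f a : R} (he : IsIdempotentElem e) (ha : a ∈ corner k e f) :
    e * a = a := by
  obtain ⟨r, rfl⟩ := ha
  simp only [LinearMap.comp_apply, LinearMap.mulLeft_apply, LinearMap.mulRight_apply]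
  rw [← mul_assoc, ← mul_assoc, he.eq]

theorem mul_eq_of_mem_corner_right {e f a : R} (hf : IsIdempotentElem f) (ha : a ∈ corner k e f) :
    a * f = a := by
  obtain ⟨r, rfl⟩ := ha
  simp only [LinearMap.comp_apply, LinearMap.mulLeft_apply, LinearMap.mulRight_apply]
  rw [mul_assoc, hf.eq]

theorem mem_corner_of_mul_eq {e f a : R} (he : e * a = a) (hf : a * f = a) : a ∈ corner k e f :=
  ⟨a, by simp [he, hf]⟩

/-- For idempotents `e` and `f`, evaluation at `e` identifies `Hom_R(R e, R f)` with `e R f`. -/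
def leftIdealHomEquiv {e f : R} (he : IsIdempotentElem e) (hf : IsIdempotentElem f) :
    LeftIdealHom e f ≃ₗ[k] corner k e f where
  toFun φ := ⟨(φ ⟨e, Submodule.mem_span_singleton_self e⟩ : R), by
    refine mem_corner_of_mul_eq ?_ ?_
    · have h := φ.map_smul e ⟨e, Submodule.mem_span_singleton_self e⟩
      have h' : e • (⟨e, Submodule.mem_span_singleton_self e⟩ : Submodule.span R {e}) =
          ⟨e, Submodule.mem_span_singleton_self e⟩ := Subtype.ext he
      rw [h'] at h
      exact (congrArg Subtype.val h).symm
    · obtain ⟨r, hr⟩ := Submodule.mem_span_singleton.1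
        (φ ⟨e, Submodule.mem_span_singleton_self e⟩).2
      rw [← hr, smul_eq_mul, mul_assoc, hf.eq]⟩
  map_add' _ _ := rfl
  map_smul' _ _ := rfl
  invFun a :=
    { toFun := fun y => ⟨y.1 * a.1, Submodule.mem_span_singleton.2 ⟨y.1 * a.1, by
        rw [smul_eq_mul, mul_assoc, mul_eq_of_mem_corner_right hf a.2]⟩⟩
      map_add' := fun y z => Subtype.ext (add_mul _ _ _)
      map_smul' := fun r y => Subtype.ext (mul_assoc _ _ _) }
  left_inv φ := by
    ext y
    obtain ⟨r, hr⟩ := Submodule.mem_span_singleton.1 y.2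
    have hy : y = y.1 • (⟨e, Submodule.mem_span_singleton_self e⟩ : Submodule.span R {e}) := by
      refine Subtype.ext ?_
      change y.1 = y.1 * e
      rw [← hr, smul_eq_mul, mul_assoc, he.eq]
    conv_rhs => rw [hy, φ.map_smul]
    rfl
  right_inv a := Subtype.ext (mul_eq_of_mem_corner_left he a.2)

theorem cartanInvariant_eq_finrank_corner {I : Type*} {e : I → R}
    (he : ∀ i, IsIdempotentElem (e i)) (i j : I) :
    cartanInvariant k e i j = Module.finrank k (corner k (e i) (e j)) :=
  (leftIdealHomEquiv (he i) (he j)).finrank_eq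

/-- An idempotent `e` with `e R e` one-dimensional is primitive. -/
theorem isPrimitiveIdempotent_of_finrank_corner {e : R} (he : IsIdempotentElem e)
    (h : Module.finrank k (corner k e e) = 1) : IsPrimitiveIdempotent e := by
  have hmem : e ∈ corner k e e := mem_corner_of_mul_eq he he
  have h0 : e ≠ 0 := by
    rintro rfl
    have hb : corner k (0 : R) 0 = ⊥ := by
      rw [eq_bot_iff]
      rintro _ ⟨r, rfl⟩
      simp
    rw [hb, finrank_bot] at h
    exact zero_ne_one h
  refine ⟨he, h0, ?_⟩
  rintro ⟨a, b, ha, hb, ha0, hb0, hab, hba, hsum⟩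
  have hamem : a ∈ corner k e e :=
    mem_corner_of_mul_eq (by rw [hsum, add_mul, ha.eq, hba, add_zero])
      (by rw [hsum, mul_add, ha.eq, hab, add_zero])
  obtain ⟨t, ht⟩ := (finrank_eq_one_iff_of_nonzero' (⟨e, hmem⟩ : corner k e e)
    (fun h' => h0 (congrArg Subtype.val h'))).1 h ⟨a, hamem⟩
  have hta : t • e = a := congrArg Subtype.val ht
  -- With `a = t e` and `e b = b`, the product `a b = 0` is `t b`, so `t = 0` or `b = 0`.
  have : t • b = 0 := by
    have h1 : a * b = t • b := by
      rw [← hta, smul_mul_assoc, hsum, add_mul, hab, zero_add, hb.eq]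
    rw [← h1, hab]
  rcases smul_eq_zero.1 this with rfl | h2
  · exact ha0 (by rw [← hta, zero_smul])
  · exact hb0 h2

end Corner

/-! ### Two computations of `dim x R e_Y` -/

namespace CentralArrangement

variable {V : Type*} [AddCommGroup V] [Module ℝ V] {A : CentralArrangement V}

noncomputable instance : Fintype A.Face := Fintype.ofFinite _

variable (k : Type*) [Field k] {c : A.IntersectionLattice → A.Face}

local notation "ι" => MonoidAlgebra.of k A.Face

instance : Module.Finite k (MonoidAlgebra k A.Face) :=
  Module.Finite.equiv (MonoidAlgebra.coeffLinearEquiv k).symm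

theorem of_isIdempotentElem (x : A.Face) : IsIdempotentElem (ι x) := by
  rw [IsIdempotentElem, ← map_mul, Face.mul_eq_left le_rfl]

variable (hc : ∀ X, (c X).supp = X)
include hc

open Classical in
/-- Left multiplication by the idempotents `e_Z`, `Z ≥ supp x`, decomposes `x R e_Y`. -/
noncomputable def cornerOfEquiv (x : A.Face) (Y : A.IntersectionLattice) :
    corner k (ι x) (idem k c Y) ≃ₗ[k]
      ∀ Z : {Z : A.IntersectionLattice // x.supp ≤ Z}, corner k (idem k c Z) (idem k c Y) where
  toFun a Z := ⟨idem k c Z * a.1, mem_corner_of_mul_eq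
    (by rw [← mul_assoc, (idem_isIdempotentElem k hc Z).eq])
    (by rw [mul_assoc, mul_eq_of_mem_corner_right (idem_isIdempotentElem k hc Y) a.2])⟩
  map_add' a b := by
    funext Z
    exact Subtype.ext (mul_add _ _ _)
  map_smul' t a := by
    funext Z
    exact Subtype.ext (mul_smul_comm _ _ _)
  invFun b := ⟨ι x * ∑ Z, (b Z).1, mem_corner_of_mul_eq
    (by rw [← mul_assoc, (of_isIdempotentElem k x).eq])
    (by
      rw [mul_assoc, Finset.sum_mul]
      congr 1
      exact Finset.sum_congr rfl fun Z _ =>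
        mul_eq_of_mem_corner_right (idem_isIdempotentElem k hc Y) (b Z).2)⟩
  left_inv a := by
    classical
    refine Subtype.ext ?_
    change ι x * ∑ Z : {Z : A.IntersectionLattice // x.supp ≤ Z}, idem k c Z * a.1 = a.1
    -- Expand `x = x * ∑ e_Z`; the terms with `Z` not above `supp x` vanish.
    have h : ι x * ∑ Z : {Z : A.IntersectionLattice // x.supp ≤ Z}, idem k c Z = ι x := by
      conv_rhs => rw [← mul_one (ι x), ← sum_idem k hc, Finset.mul_sum]
      rw [Finset.mul_sum, ← Finset.sum_subtype (Finset.univ.filter (x.supp ≤ ·)) (by simp)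
        fun Z => ι x * idem k c Z]
      refine Finset.sum_subset (Finset.subset_univ _) fun Z _ hZ => ?_
      exact of_mul_idem_eq_zero k hc Z (by simpa using hZ)
    rw [← Finset.sum_mul, ← mul_assoc, h, mul_eq_of_mem_corner_left (of_isIdempotentElem k x) a.2]
  right_inv b := by
    classical
    funext W
    refine Subtype.ext ?_
    change idem k c W * (ι x * ∑ Z, (b Z).1) = (b W).1
    -- `e_W` absorbs `x`, and orthogonality leaves only the component at `W`.
    rw [← mul_assoc, idem_mul_of k hc W.2, Finset.mul_sum, Finset.sum_eq_single W]
    · exact mul_eq_of_mem_corner_left (idem_isIdempotentElem k hc W) (b W).2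
    · intro Z _ hZ
      rw [← mul_eq_of_mem_corner_left (idem_isIdempotentElem k hc Z) (b Z).2, ← mul_assoc,
        (completeOrthogonalIdempotents_idem k hc).ortho fun h => hZ (Subtype.ext h).symm, zero_mul]
    · simp

open Classical in
theorem finrank_corner_of_eq_sum (x : A.Face) (Y : A.IntersectionLattice) :
    Module.finrank k (corner k (ι x) (idem k c Y)) =
      ∑ Z : {Z : A.IntersectionLattice // x.supp ≤ Z},
        Module.finrank k (corner k (idem k c Z) (idem k c Y)) := by
  rw [(cornerOfEquiv k hc x Y).finrank_eq, Module.finrank_pi_fintype]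

/-- The corrections `w e_Z`, `Z > supp w`, involve only faces with support above `Z`. Hence, among
faces of the same support as `w`, only `w` itself occurs in `w e_{supp w}`. -/
theorem coeff_of_mul_idem {w v : A.Face} (h : v.supp = w.supp) :
    (ι w * idem k c w.supp).coeff v = (ι w).coeff v := by
  classical
  rw [of_mul_idem_of_supp_eq k hc rfl, MonoidAlgebra.coeff_sub, Finsupp.sub_apply, sub_eq_self,
    MonoidAlgebra.coeff_sum, Finsupp.finsetSum_apply]
  refine Finset.sum_eq_zero fun Z hZ => ?_
  rw [idem_eq_of_mul, ← mul_assoc, ← map_mul]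
  refine coeff_of_mul_eq_zero k (fun hle => ?_) _
  have h1 := (hc Z).ge.trans ((Face.supp_le_supp_mul_right w (c Z)).trans hle)
  rw [h] at h1
  exact (Finset.mem_filter.1 hZ).2.not_ge h1

theorem linearIndependent_of_mul_idem (x : A.Face) (Y : A.IntersectionLattice) :
    LinearIndependent k (fun w : {w : A.Face // w.supp = Y ∧ x * w = w} =>
      ι w.1 * idem k c Y) := by
  classical
  let P : MonoidAlgebra k A.Face →ₗ[k] ({w : A.Face // w.supp = Y ∧ x * w = w} → k) :=
    LinearMap.pi fun v => Finsupp.lapply v.1 ∘ₗ (MonoidAlgebra.coeffLinearEquiv k).toLinearMap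
  refine LinearIndependent.of_comp P ?_
  have hP : (P ∘ fun w : {w : A.Face // w.supp = Y ∧ x * w = w} => ι w.1 * idem k c Y) =
      fun w => Pi.single w 1 := by
    funext w v
    change (ι w.1 * idem k c Y).coeff v.1 = _
    have h := coeff_of_mul_idem k hc (w := w.1) (v := v.1) (v.2.1.trans w.2.1.symm)
    rw [w.2.1] at h
    rw [h, MonoidAlgebra.of_apply, MonoidAlgebra.coeff_single, Finsupp.single_apply, Pi.single_apply]
    simp [Subtype.ext_iff, eq_comm]
  rw [hP]
  convert (Pi.basisFun k {w : A.Face // w.supp = Y ∧ x * w = w}).linearIndependent using 1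
  funext w
  rw [Pi.basisFun_apply]

theorem span_of_mul_idem (x : A.Face) (Y : A.IntersectionLattice) :
    Submodule.span k (Set.range fun w : {w : A.Face // w.supp = Y ∧ x * w = w} =>
      ι w.1 * idem k c Y) = corner k (ι x) (idem k c Y) := by
  apply le_antisymm
  · rw [Submodule.span_le]
    rintro _ ⟨w, rfl⟩
    refine mem_corner_of_mul_eq ?_ ?_
    · rw [← mul_assoc, ← map_mul, w.2.2]
    · rw [mul_assoc, (idem_isIdempotentElem k hc Y).eq]
  · rintro _ ⟨r, rfl⟩
    simp only [LinearMap.comp_apply, LinearMap.mulLeft_apply, LinearMap.mulRight_apply]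
    induction r using MonoidAlgebra.induction_on with
    | add a b ha hb =>
      rw [mul_add, add_mul]
      exact Submodule.add_mem _ ha hb
    | smul t a ha =>
      rw [mul_smul_comm, smul_mul_assoc]
      exact Submodule.smul_mem _ t ha
    | of w =>
      rw [← map_mul]
      by_cases hw : (x * w).supp ≤ Y
      -- Since `c Y * e_Y = e_Y`, the face can be multiplied by `c Y`, which raises its support to
      -- exactly `Y`.
      · have h0 : ι (x * w) * idem k c Y = ι (x * w * c Y) * idem k c Y := by
          rw [map_mul ι (x * w), mul_assoc, of_mul_idem_self k Y]
        have h1 : (x * w * c Y).supp = Y := le_antisymm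
          ((Face.supp_mul_le_iff _ _ _).2 ⟨hw, (hc Y).le⟩)
          ((hc Y).ge.trans (Face.supp_le_supp_mul_right _ _))
        have h2 : x * (x * w * c Y) = x * w * c Y := by
          rw [← mul_assoc, ← mul_assoc, Face.mul_eq_left (le_refl x.supp)]
        rw [h0]
        exact Submodule.subset_span ⟨⟨x * w * c Y, h1, h2⟩, rfl⟩
      · rw [of_mul_idem_eq_zero k hc Y hw]
        exact Submodule.zero_mem _

theorem finrank_corner_of_eq_card (x : A.Face) (Y : A.IntersectionLattice) :
    Module.finrank k (corner k (ι x) (idem k c Y)) =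
      Nat.card {w : A.Face // w.supp = Y ∧ x * w = w} := by
  classical
  rw [← span_of_mul_idem k hc, finrank_span_eq_card (linearIndependent_of_mul_idem k hc x Y),
    Nat.card_eq_fintype_card]

theorem corner_idem_eq_bot {X Y : A.IntersectionLattice} (h : ¬ X ≤ Y) :
    corner k (idem k c X) (idem k c Y) = ⊥ := by
  rw [eq_bot_iff]
  rintro _ ⟨r, rfl⟩
  exact idem_mul_mul_idem_eq_zero k hc h r

end CentralArrangement

/-! ### The Euler relation for convex cells cut by hyperplanes -/

open Module in
theorem Submodule.finrank_inf_ker_add_one {K V : Type*} [Field K] [AddCommGroup V] [Module K V]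
    [FiniteDimensional K V] (W : Submodule K V) (f : Dual K V) {q : V} (hq : q ∈ W)
    (hf : f q ≠ 0) : finrank K ↥(W ⊓ LinearMap.ker f) + 1 = finrank K W := by
  have h0 : f.domRestrict W ≠ 0 := fun h => hf (LinearMap.congr_fun h ⟨q, hq⟩)
  rw [← Module.Dual.finrank_ker_add_one_of_ne_zero h0, ← Submodule.map_comap_subtype,
    Submodule.finrank_map_subtype_eq, LinearMap.ker_domRestrict]

section EulerRelation

open Module Filter Topology

variable {V : Type*} [AddCommGroup V] [Module ℝ V]

theorem convex_setOf_sign_eq (f : Dual ℝ V) (ε : SignType) :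
    Convex ℝ {v | SignType.sign (f v) = ε} := by
  cases ε with
  | pos =>
    simpa only [SignType.pos_eq_one, sign_eq_one_iff] using convex_halfSpace_gt f.isLinear 0
  | neg =>
    simpa only [SignType.neg_eq_neg_one, sign_eq_neg_one_iff] using convex_halfSpace_lt f.isLinear 0
  | zero =>
    simpa only [SignType.zero_eq_zero, sign_eq_zero_iff] using convex_hyperplane f.isLinear 0

theorem eventually_sign_add_smul_eq (f : Dual ℝ V) {p : V} (q : V) (hp : f p ≠ 0) :
    ∀ᶠ t : ℝ in 𝓝[>] 0, SignType.sign (f (p + t • q)) = SignType.sign (f p) := by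
  have hc : Tendsto (fun t : ℝ => f (p + t • q)) (𝓝[>] 0) (𝓝 (f p)) := by
    have : Continuous (fun t : ℝ => f p + t * f q) := by fun_prop
    have h2 := (this.tendsto 0).mono_left (nhdsWithin_le_nhds (s := Set.Ioi 0))
    simpa using h2
  rcases lt_or_gt_of_ne hp with h | h
  · filter_upwards [hc.eventually_lt_const h] with t ht
    rw [sign_neg ht, sign_neg h]
  · filter_upwards [hc.eventually_const_lt h] with t ht
    rw [sign_pos ht, sign_pos h]

/-- A nonempty convex subset of a subspace which is algebraically open in it. -/
structure IsConvexCell (W : Submodule ℝ V) (K : Set V) : Prop where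
  convex : Convex ℝ K
  subset : K ⊆ W
  nonempty : K.Nonempty
  eventually_mem : ∀ p ∈ K, ∀ q ∈ W, ∀ᶠ t : ℝ in 𝓝[>] 0, p + t • q ∈ K

/-- A nonzero sign survives small moves in every direction of `W`, whereas sign zero survives only
moves inside `ker f`. -/
theorem IsConvexCell.inter_sign {W : Submodule ℝ V} {K : Set V} (h : IsConvexCell W K)
    (f : Dual ℝ V) (ε : SignType) (hne : (K ∩ {v | SignType.sign (f v) = ε}).Nonempty) :
    IsConvexCell (if ε = 0 then W ⊓ LinearMap.ker f else W)
      (K ∩ {v | SignType.sign (f v) = ε}) where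
  convex := h.convex.inter (convex_setOf_sign_eq f ε)
  nonempty := hne
  subset := by
    rintro v ⟨hv, hs⟩
    split_ifs with hε
    · exact ⟨h.subset hv, sign_eq_zero_iff.1 (hs.trans hε)⟩
    · exact h.subset hv
  eventually_mem := by
    rintro p ⟨hp, hs⟩ q hq
    split_ifs at hq with hε
    · filter_upwards [h.eventually_mem p hp q hq.1] with t ht
      refine ⟨ht, ?_⟩
      have h1 : f q = 0 := hq.2
      have h2 : f p = 0 := sign_eq_zero_iff.1 (hs.trans hε)
      simp [h1, h2, hε]
    · have hp0 : f p ≠ 0 := fun h0 => hε (hs.symm.trans (by rw [h0, sign_zero]))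
      filter_upwards [h.eventually_mem p hp q hq, eventually_sign_add_smul_eq f q hp0] with t ht ht'
      exact ⟨ht, ht'.trans hs⟩

/-- The sign `(-1) ^ dim W`. -/
noncomputable def dimSign (W : Submodule ℝ V) : ℤ := (-1) ^ finrank ℝ W

variable [FiniteDimensional ℝ V]

open Classical in
/-- Cutting a convex cell by one hyperplane preserves the Euler characteristic. -/
theorem IsConvexCell.sum_sign {W : Submodule ℝ V} {K : Set V} (h : IsConvexCell W K)
    (f : Dual ℝ V) :
    ∑ ε : SignType, (if (K ∩ {v | SignType.sign (f v) = ε}).Nonempty then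
      dimSign (if ε = 0 then W ⊓ LinearMap.ker f else W) else 0) =
      dimSign W := by
  obtain ⟨p, hp⟩ := h.nonempty
  have huniv : (Finset.univ : Finset SignType) = {0, -1, 1} := rfl
  rw [huniv, Finset.sum_insert (by decide), Finset.sum_insert (by decide), Finset.sum_singleton]
  simp only [if_true, if_neg (show (-1 : SignType) ≠ 0 by decide),
    if_neg (show (1 : SignType) ≠ 0 by decide), Set.Nonempty, Set.mem_inter_iff, Set.mem_ofPred_eq,
    sign_eq_zero_iff, sign_eq_one_iff, sign_eq_neg_one_iff]
  by_cases hW : ∀ q ∈ W, f q = 0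
  · have hK : ∀ v ∈ K, f v = 0 := fun v hv => hW v (h.subset hv)
    rw [if_pos ⟨p, hp, hK p hp⟩, if_neg, if_neg, inf_eq_left.2 hW, add_zero, add_zero]
    · rintro ⟨v, hv, h'⟩
      exact h'.ne' (hK v hv)
    · rintro ⟨v, hv, h'⟩
      exact h'.ne (hK v hv)
  push Not at hW
  obtain ⟨q, hq, hfq⟩ : ∃ q ∈ W, 0 < f q := by
    obtain ⟨q, hq, hfq⟩ := hW
    rcases lt_or_gt_of_ne hfq with h' | h'
    · exact ⟨-q, W.neg_mem hq, by simpa using h'⟩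
    · exact ⟨q, hq, h'⟩
  -- If the hyperplane meets `K`, moving by `±q` shows that all three pieces occur; the middle one
  -- has dimension one less, so the signs add up to `-s + s + s = s`. Otherwise convexity keeps `K`
  -- on one side.
  by_cases h0 : ∃ v ∈ K, f v = 0
  · obtain ⟨v, hv, hfv⟩ := h0
    have hpos : ∃ x ∈ K, 0 < f x := by
      obtain ⟨t, ht, ht0⟩ := ((h.eventually_mem v hv q hq).and self_mem_nhdsWithin).exists
      exact ⟨_, ht, by simpa [hfv] using mul_pos ht0 hfq⟩
    have hneg : ∃ x ∈ K, f x < 0 := by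
      obtain ⟨t, ht, ht0⟩ :=
        ((h.eventually_mem v hv (-q) (W.neg_mem hq)).and self_mem_nhdsWithin).exists
      exact ⟨_, ht, by simpa [hfv] using mul_pos ht0 hfq⟩
    rw [if_pos ⟨v, hv, hfv⟩, if_pos hpos, if_pos hneg, dimSign, dimSign,
      ← W.finrank_inf_ker_add_one f hq hfq.ne', pow_succ]
    ring
  · rw [if_neg h0, zero_add]
    have hnot : ¬ ((∃ x ∈ K, f x < 0) ∧ ∃ x ∈ K, 0 < f x) := by
      rintro ⟨⟨x, hx, hfx⟩, y, hy, hfy⟩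
      -- The zero of `f` on the segment from `x` to `y`.
      refine h0 ⟨(f y / (f y - f x)) • x + (-f x / (f y - f x)) • y,
        h.convex hx hy (by apply div_nonneg <;> linarith) (by apply div_nonneg <;> linarith) ?_, ?_⟩
      · have : f y - f x ≠ 0 := by linarith
        field_simp
        ring
      · simp only [map_add, map_smul, smul_eq_mul]
        ring
    rcases lt_or_gt_of_ne (fun h' => h0 ⟨p, hp, h'⟩ : f p ≠ 0) with h' | h'
    · rw [if_pos ⟨p, hp, h'⟩, if_neg fun h1 => hnot ⟨⟨p, hp, h'⟩, h1⟩, add_zero]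
    · rw [if_neg fun h1 => hnot ⟨h1, ⟨p, hp, h'⟩⟩, if_pos ⟨p, hp, h'⟩, zero_add]

open Classical in
/-- The Euler relation for the pieces into which hyperplanes cut a convex cell, indexed by `Fin n`. -/
theorem IsConvexCell.sum_realizable_fin (n : ℕ) : ∀ {W : Submodule ℝ V} {K : Set V}
    (_ : IsConvexCell W K) (f : Fin n → Dual ℝ V),
    ∑ σ : Fin n → SignType, (if ∃ v ∈ K, ∀ i, SignType.sign (f i v) = σ i then
      dimSign (W ⊓ ⨅ i, ⨅ (_ : σ i = 0), LinearMap.ker (f i)) else 0) =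
      dimSign W := by
  induction n with
  | zero =>
    intro W K h f
    have : ∃ v, v ∈ K := h.nonempty
    simp [this]
  | succ n ih =>
    intro W K h f
    -- Group sign vectors by the first sign: each group is the relation for one piece cut out by `f
    -- 0`, with `n` forms left.
    rw [← h.sum_sign (f 0), ← (Fin.consEquiv fun _ : Fin (n + 1) => SignType).sum_comp,
      Fintype.sum_prod_type]
    refine Finset.sum_congr rfl fun ε _ => ?_
    have hex : ∀ σ : Fin n → SignType,
        (∃ v ∈ K, ∀ i, SignType.sign (f i v) = Fin.consEquiv (fun _ => SignType) (ε, σ) i) ↔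
          ∃ v ∈ K ∩ {v | SignType.sign (f 0 v) = ε},
            ∀ i, SignType.sign (f (Fin.succ i) v) = σ i := by
      intro σ
      simp [Fin.forall_fin_succ, and_assoc]
    have hsub : ∀ σ : Fin n → SignType,
        (W ⊓ ⨅ i, ⨅ (_ : Fin.consEquiv (fun _ => SignType) (ε, σ) i = 0), LinearMap.ker (f i)) =
          (if ε = 0 then W ⊓ LinearMap.ker (f 0) else W) ⊓
            ⨅ i, ⨅ (_ : σ i = 0), LinearMap.ker (f (Fin.succ i)) := by
      intro σ
      ext v
      by_cases hε : ε = 0 <;>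
        simp [Submodule.mem_iInf, Fin.forall_fin_succ, hε, and_assoc]
    simp only [hex, hsub]
    by_cases hne : (K ∩ {v | SignType.sign (f 0 v) = ε}).Nonempty
    · rw [if_pos hne]
      exact ih (h.inter_sign (f 0) ε hne) fun i => f i.succ
    · rw [if_neg hne]
      refine Finset.sum_eq_zero fun σ _ => if_neg ?_
      rintro ⟨v, hv, -⟩
      exact hne ⟨v, hv⟩

open Classical in
/-- The Euler relation for the pieces into which finitely many hyperplanes cut a convex cell. -/
theorem IsConvexCell.sum_realizable {I : Type*} [Fintype I] [DecidableEq I]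
    {W : Submodule ℝ V} {K : Set V}
    (h : IsConvexCell W K) (f : I → Dual ℝ V) :
    ∑ σ : I → SignType, (if ∃ v ∈ K, ∀ i, SignType.sign (f i v) = σ i then
      dimSign (W ⊓ ⨅ i, ⨅ (_ : σ i = 0), LinearMap.ker (f i)) else 0) =
      dimSign W := by
  let e := Fintype.equivFin I
  rw [← h.sum_realizable_fin _ (f ∘ e.symm), ← (e.arrowCongr (Equiv.refl SignType)).sum_comp]
  refine Finset.sum_congr rfl fun σ _ => ?_
  have h1 : ∀ v, (∀ i, SignType.sign (f i v) = σ i) ↔ ∀ j, SignType.sign ((f ∘ e.symm) j v) =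
      e.arrowCongr (Equiv.refl SignType) σ j := fun v => by
    rw [← e.symm.forall_congr_right]
    rfl
  have h2 : (⨅ i, ⨅ (_ : σ i = 0), LinearMap.ker (f i)) =
      ⨅ j, ⨅ (_ : e.arrowCongr (Equiv.refl SignType) σ j = 0),
        LinearMap.ker ((f ∘ e.symm) j) := by
    rw [← e.symm.iInf_comp]
    rfl
  simp only [h1, h2]

end EulerRelation

/-! ### Counting faces and inverting in the incidence algebra -/

namespace CentralArrangement

variable {V : Type*} [AddCommGroup V] [Module ℝ V] {A : CentralArrangement V}

theorem Face.span_eq_inf {w : A.Face} {Y : A.IntersectionLattice} (h : w.supp ≤ Y) :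
    w.span = Y.1 ⊓ ⨅ H, ⨅ (_ : w.sign H = 0), LinearMap.ker (A.form H) := by
  simp only [A.ker_form]
  exact (inf_eq_right.2 h).symm

/-- This cone is the union of the faces `w` with `x * w = w` and support below `Y`, the star of `x`
within `Y`. -/
theorem Face.isConvexCell (x : A.Face) {Y : A.IntersectionLattice} (h : x.supp ≤ Y) :
    IsConvexCell Y.1 ((Y.1 : Set V) ∩
      ⋂ H, ⋂ (_ : x.sign H ≠ 0), {v | SignType.sign (A.form H v) = x.sign H}) where
  convex := Y.1.convex.inter
    (convex_iInter₂ fun H _ => convex_setOf_sign_eq (A.form H) (x.sign H))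
  subset := Set.inter_subset_left
  nonempty := by
    obtain ⟨v, hv⟩ := x.exists_mem_carrier
    exact ⟨v, h ((x.mem_span_iff v).2 fun H hH => sign_eq_zero_iff.1 ((hv H).trans hH)),
      Set.mem_iInter₂.2 fun H _ => hv H⟩
  eventually_mem := by
    rintro p ⟨hp, hs⟩ q hq
    have hs' := Set.mem_iInter₂.1 hs
    have key : ∀ H, ∀ᶠ t : ℝ in nhdsWithin 0 (Set.Ioi 0), x.sign H ≠ 0 →
        SignType.sign (A.form H (p + t • q)) = x.sign H := by
      intro H
      by_cases hH : x.sign H = 0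
      · exact Filter.Eventually.of_forall fun t h' => absurd hH h'
      · have hpH : SignType.sign (A.form H p) = x.sign H := hs' H hH
        have hp0 : A.form H p ≠ 0 := fun h0 => hH (by rw [← hpH, h0, sign_zero])
        filter_upwards [eventually_sign_add_smul_eq (A.form H) q hp0] with t ht _
        exact ht.trans hpH
    filter_upwards [Filter.eventually_all.2 key] with t ht
    exact ⟨Y.1.add_mem hp (Y.1.smul_mem t hq), Set.mem_iInter₂.2 ht⟩

open Classical in
/-- The Euler relation for the faces of the restriction to `Y` that contain `x`. -/
theorem Face.sum_dimSign [FiniteDimensional ℝ V] (x : A.Face) {Y : A.IntersectionLattice}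
    (h : x.supp ≤ Y) :
    ∑ w : A.Face, (if x * w = w ∧ w.supp ≤ Y then dimSign w.span else 0) = dimSign Y.1 := by
  rw [← IsConvexCell.sum_realizable (x.isConvexCell h) A.form]
  -- Sign vectors that are not faces are not realized and contribute zero.
  refine Fintype.sum_of_injective (M := ℤ) (Face.sign (A := A)) (fun _ _ h => Face.ext h) _ _ ?_ ?_
  · intro σ hσ
    refine if_neg ?_
    rintro ⟨v, -, hv⟩
    exact hσ ⟨⟨σ, v, Set.mem_iInter.2 fun H => (A.mem_side_iff H _ _).2 (hv H)⟩, rfl⟩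
  · intro w
    have hiff : (x * w = w ∧ w.supp ≤ Y) ↔ ∃ v ∈ (Y.1 : Set V) ∩
        ⋂ H, ⋂ (_ : x.sign H ≠ 0), {v | SignType.sign (A.form H v) = x.sign H},
        ∀ H, SignType.sign (A.form H v) = w.sign H := by
      rw [Face.mul_eq_right_iff]
      constructor
      · rintro ⟨h1, h2⟩
        obtain ⟨v, hv⟩ := w.exists_mem_carrier
        refine ⟨v, ⟨h2 ((w.mem_span_iff v).2 fun H hH => sign_eq_zero_iff.1 ((hv H).trans hH)),
          Set.mem_iInter₂.2 fun H hH => (hv H).trans (h1 H hH)⟩, hv⟩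
      · rintro ⟨v, ⟨hvY, hvx⟩, hv⟩
        refine ⟨fun H hH => (hv H).symm.trans (Set.mem_iInter₂.1 hvx H hH), ?_⟩
        obtain ⟨y, rfl⟩ := Face.supp_surjective Y
        refine (Face.supp_le_supp_iff _ _).2 fun H hH => ?_
        rw [← hv H, (y.mem_span_iff v).1 hvY H hH, sign_zero]
    by_cases hw : x * w = w ∧ w.supp ≤ Y
    · rw [if_pos hw, if_pos (hiff.1 hw), Face.span_eq_inf hw.2]
    · rw [if_neg hw, if_neg fun h' => hw (hiff.2 h')]

theorem _root_.dimSign_mul_self (W : Submodule ℝ V) : dimSign W * dimSign W = 1 := by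
  rw [dimSign, ← mul_pow]
  simp

variable (k : Type*) [Field k] {c : A.IntersectionLattice → A.Face}

/-- The sign `(-1) ^ dim X` as a diagonal element of the incidence algebra. -/
noncomputable def signDiag (A : CentralArrangement V) : IncidenceAlgebra ℤ A.IntersectionLattice :=
  ⟨fun X Y => if X = Y then dimSign X.1 else 0, fun _ _ h => if_neg fun h' => h h'.le⟩

variable (hc : ∀ X, (c X).supp = X)

/-- The dimensions of `e_X R e_Y`, as an element of the incidence algebra. -/
noncomputable def cornerDim : IncidenceAlgebra ℤ A.IntersectionLattice :=
  ⟨fun X Y => (Module.finrank k (corner k (idem k c X) (idem k c Y)) : ℤ), fun _ _ h => by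
    rw [corner_idem_eq_bot k hc h, finrank_bot, Nat.cast_zero]⟩

-- Both sides are `dim x R e_Y` for `x = c X`: the left by the decomposition along the `e_Z`, the
-- right by the basis.
open Classical IncidenceAlgebra in
theorem zeta_mul_cornerDim_apply (X Y : A.IntersectionLattice) :
    (zeta ℤ * cornerDim k hc : IncidenceAlgebra ℤ _) X Y =
      Nat.card {w : A.Face // w.supp = Y ∧ c X * w = w} := by
  rw [← finrank_corner_of_eq_card k hc, finrank_corner_of_eq_sum k hc, mul_apply, Nat.cast_sum]
  rw [← Finset.sum_subtype (Finset.univ.filter (X ≤ ·)) (by simp [hc])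
    fun Z => (Module.finrank k (corner k (idem k c Z) (idem k c Y)) : ℤ)]
  have h1 : ∀ Z ∈ Finset.Icc X Y, zeta ℤ X Z * cornerDim k hc Z Y =
      (Module.finrank k (corner k (idem k c Z) (idem k c Y)) : ℤ) := fun Z hZ => by
    rw [zeta_of_le (Finset.mem_Icc.1 hZ).1, one_mul]
    rfl
  rw [Finset.sum_congr rfl h1]
  refine Finset.sum_subset (fun Z hZ => by simpa using (Finset.mem_Icc.1 hZ).1) fun Z hZ hZ' => ?_
  have hXZ : X ≤ Z := by simpa using hZ
  rw [corner_idem_eq_bot k hc fun hZY => hZ' (Finset.mem_Icc.2 ⟨hXZ, hZY⟩), finrank_bot,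
    Nat.cast_zero]

open IncidenceAlgebra in
theorem mul_signDiag_apply (f : IncidenceAlgebra ℤ A.IntersectionLattice)
    (X Y : A.IntersectionLattice) : (f * A.signDiag) X Y = f X Y * dimSign Y.1 := by
  have hd : ∀ Z, A.signDiag Z Y = if Z = Y then dimSign Z.1 else 0 := fun _ => rfl
  rw [mul_apply]
  simp only [hd]
  by_cases h : X ≤ Y
  · rw [Finset.sum_eq_single_of_mem Y (Finset.mem_Icc.2 ⟨h, le_rfl⟩), if_pos rfl]
    intro Z _ hZ
    rw [if_neg hZ, mul_zero]
  · rw [Finset.Icc_eq_empty h, Finset.sum_empty, apply_eq_zero_of_not_le h, zero_mul]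

open IncidenceAlgebra in
theorem signDiag_mul_apply (f : IncidenceAlgebra ℤ A.IntersectionLattice)
    (X Y : A.IntersectionLattice) : (A.signDiag * f) X Y = dimSign X.1 * f X Y := by
  have hd : ∀ Z, A.signDiag X Z = if X = Z then dimSign X.1 else 0 := fun _ => rfl
  rw [mul_apply]
  simp only [hd]
  by_cases h : X ≤ Y
  · rw [Finset.sum_eq_single_of_mem X (Finset.mem_Icc.2 ⟨le_rfl, h⟩), if_pos rfl]
    intro Z _ hZ
    rw [if_neg hZ.symm, zero_mul]
  · rw [Finset.Icc_eq_empty h, Finset.sum_empty, apply_eq_zero_of_not_le h, mul_zero]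

-- This is the Euler relation for `c X` in `Y`, with the faces grouped by their support `Z`.
open Classical IncidenceAlgebra in
theorem zeta_mul_cornerDim_mul_signDiag_mul_zeta [FiniteDimensional ℝ V] :
    zeta ℤ * cornerDim k hc * A.signDiag * zeta ℤ = zeta ℤ * A.signDiag := by
  ext X Y hXY
  rw [mul_apply, mul_signDiag_apply, zeta_of_le hXY, one_mul,
    ← (c X).sum_dimSign ((hc X).le.trans hXY)]
  have hcard : ∀ Z : A.IntersectionLattice,
      (Nat.card {w : A.Face // w.supp = Z ∧ c X * w = w} : ℤ) * dimSign Z.1 =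
        ∑ w : A.Face, if w.supp = Z then (if c X * w = w then dimSign w.span else 0) else 0 := by
    intro Z
    have h1 : ∀ w : A.Face,
        (if w.supp = Z then (if c X * w = w then dimSign w.span else 0) else 0) =
          if w.supp = Z ∧ c X * w = w then dimSign Z.1 else 0 := by
      intro w
      by_cases hw : w.supp = Z
      · simp only [hw, true_and, if_true]
        have : w.span = Z.1 := congrArg Subtype.val hw
        rw [this]
      · simp [hw]
    simp only [h1]
    rw [← Finset.sum_filter, Finset.sum_const, nsmul_eq_mul, Nat.card_eq_fintype_card,
      Fintype.card_subtype]
  have hterm : ∀ Z ∈ Finset.Icc X Y,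
      (zeta ℤ * cornerDim k hc * A.signDiag : IncidenceAlgebra ℤ _) X Z * zeta ℤ Z Y =
        ∑ w : A.Face, if w.supp = Z then (if c X * w = w then dimSign w.span else 0) else 0 := by
    intro Z hZ
    rw [zeta_of_le (Finset.mem_Icc.1 hZ).2, mul_one, mul_signDiag_apply,
      zeta_mul_cornerDim_apply, hcard]
  rw [Finset.sum_congr rfl hterm, Finset.sum_comm]
  refine Finset.sum_congr rfl fun w _ => ?_
  rw [Finset.sum_ite_eq]
  by_cases hw : c X * w = w
  · have hX : X ≤ w.supp := by
      rw [← hw]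
      exact (hc X).ge.trans (Face.supp_le_supp_mul_left _ _)
    simp [hw, hX]
  · simp [hw]

-- Cancel `ζ` on both sides by Möbius inversion; the sign diagonal is its own inverse.
open Classical IncidenceAlgebra in
theorem cornerDim_apply [FiniteDimensional ℝ V] (X Y : A.IntersectionLattice) :
    cornerDim k hc X Y = dimSign X.1 * mobius X Y * dimSign Y.1 := by
  have h1 : cornerDim k hc * A.signDiag * zeta ℤ = A.signDiag := by
    have h := congrArg (mu ℤ * ·) (zeta_mul_cornerDim_mul_signDiag_mul_zeta k hc)
    simpa only [← mul_assoc, mu_mul_zeta, one_mul] using h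
  have h2 : cornerDim k hc * A.signDiag = A.signDiag * mu ℤ := by
    have h := congrArg (· * mu ℤ) h1
    simpa only [mul_assoc, zeta_mul_mu, mul_one] using h
  have h3 : cornerDim k hc X Y * dimSign Y.1 = dimSign X.1 * mobius X Y := by
    rw [← mul_signDiag_apply, h2, signDiag_mul_apply]
    rfl
  rw [← h3, mul_assoc, dimSign_mul_self, mul_one]

include hc in
theorem finrank_corner_idem [FiniteDimensional ℝ V] (X Y : A.IntersectionLattice) :
    (Module.finrank k (corner k (idem k c X) (idem k c Y)) : ℤ) = |mobius X Y| := by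
  have habs : ∀ W : Submodule ℝ V, |dimSign W| = 1 := fun W => by simp [dimSign, abs_pow]
  have h := cornerDim_apply k hc X Y
  have h' : (Module.finrank k (corner k (idem k c X) (idem k c Y)) : ℤ) =
    dimSign X.1 * mobius X Y * dimSign Y.1 := h
  rw [← abs_of_nonneg (Nat.cast_nonneg (α := ℤ)
    (Module.finrank k (corner k (idem k c X) (idem k c Y)))), h', abs_mul, abs_mul, habs, habs,
    one_mul, mul_one]

end CentralArrangement

/-- Every finite partial order has a linear extension. -/
theorem exists_monotone_equiv_fin (α : Type*) [PartialOrder α] [Fintype α] :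
    ∃ σ : α ≃ Fin (Fintype.card α), Monotone σ := by
  let : Fintype (LinearExtension α) := inferInstanceAs (Fintype α)
  let e : Fin (Fintype.card α) ≃o LinearExtension α := Fintype.orderIsoFinOfCardEq _ rfl
  exact ⟨e.symm.toEquiv, fun _ _ h => e.symm.monotone (toLinearExtension.monotone h)⟩

/-! ### Primitivity, triangularity and the determinant -/

theorem mainTheorem3 (d : ℕ) (A : CentralArrangement (EuclideanSpace ℝ (Fin d)))
    (k : Type*) [Field k]
    (c : A.IntersectionLattice → A.Face) (hc : ∀ X, (c X).supp = X) :
    IsCompletePrimitiveSystem (CentralArrangement.idem k c) ∧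
    (∀ X Y : A.IntersectionLattice,
      Module.Finite k
        (LeftIdealHom (CentralArrangement.idem k c X) (CentralArrangement.idem k c Y)) ∧
      (cartanInvariant k (CentralArrangement.idem k c) X Y : ℤ) =
        |CentralArrangement.mobius X Y|) ∧
    (∃ σ : A.IntersectionLattice ≃ Fin (Fintype.card A.IntersectionLattice),
      Monotone σ ∧
        (Matrix.reindex σ σ
          (cartanMatrix k (CentralArrangement.idem k c))).IsUpperTriangular) ∧
    (cartanMatrix k (CentralArrangement.idem k c)).det = 1 := by
  have hidem := CentralArrangement.idem_isIdempotentElem k hc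
  have hcartan : ∀ X Y, (cartanInvariant k (CentralArrangement.idem k c) X Y : ℤ) =
      |CentralArrangement.mobius X Y| := fun X Y => by
    rw [cartanInvariant_eq_finrank_corner hidem, CentralArrangement.finrank_corner_idem k hc]
  have hself : ∀ X : A.IntersectionLattice, CentralArrangement.mobius X X = 1 := fun X =>
    IncidenceAlgebra.mu_self X
  obtain ⟨σ, hσ⟩ := exists_monotone_equiv_fin A.IntersectionLattice
  have htri : (Matrix.reindex σ σ
      (cartanMatrix k (CentralArrangement.idem k c))).IsUpperTriangular := by
    intro i j hij
    have hnot : ¬ σ.symm i ≤ σ.symm j := fun h => by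
      have := hσ h
      simp only [Equiv.apply_symm_apply] at this
      exact absurd hij this.not_gt
    change (cartanInvariant k (CentralArrangement.idem k c) (σ.symm i) (σ.symm j) : ℤ) = 0
    rw [hcartan, CentralArrangement.mobius, IncidenceAlgebra.apply_eq_zero_of_not_le hnot, abs_zero]
  refine ⟨⟨CentralArrangement.completeOrthogonalIdempotents_idem k hc, fun X => ?_⟩,
    fun X Y => ⟨?_, hcartan X Y⟩, ⟨σ, hσ, htri⟩, ?_⟩
  -- `μ(X, X) = 1` makes `e_X R e_X` one-dimensional.
  · refine isPrimitiveIdempotent_of_finrank_corner (k := k) (hidem X) ?_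
    have h := CentralArrangement.finrank_corner_idem k hc X X
    rw [hself, abs_one] at h
    exact_mod_cast h
  · exact Module.Finite.equiv (leftIdealHomEquiv (k := k) (hidem X) (hidem Y)).symm
  · rw [← Matrix.det_reindex_self σ, Matrix.det_of_isUpperTriangular htri]
    refine Finset.prod_eq_one fun i _ => ?_
    change (cartanInvariant k (CentralArrangement.idem k c) (σ.symm i) (σ.symm i) : ℤ) = 1
    rw [hcartan, hself, abs_one]
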